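/- Let $n\ge 1$, let $\Delta^{n+1}=\{\lambda\in\mathbb{R}^{n+1}_{+}:\sum_{j=1}^{n+1}\lambda_j=1\}$, and let $\mathcal{P}=(P^i)_{i=1}^n$ be the SOS2 constraint on $\Delta^{n+1}$, i.e. $P^i=\{\lambda\in\Delta^{n+1}:\lambda_j\le 0\ \ \forall j\notin\{i,i+1\}\}$. For pairwise distinct $h^1,\dots,h^n\in\{0,1\}^k$ and $H=(h^i)_{i=1}^n$ put $$Q(\mathcal{P},H)=\operatorname{conv}\Bigl(\bigcup_{i=1}^n P^i\times\{h^i\}\Bigr)\subseteq\mathbb{R}^{n+1}\times\mathbb{R}^k .$$ *Sizes.* The size of a polyhedron $Q$, $\operatorname{size}(Q)$, is the minimum of $2e+m$ over all descriptions of $Q$ by $e$ linear equations and $m$ linear inequalities, each of the $m$ inequalities being strict at some point of $Q$ (so equations count as two inequalities, and whatever holds with equality on all of $Q$ has to be written as an equation). Let $h^0=h^1$, $h^{n+1}=h^n$, $c^i=h^{i+1}-h^i$ for $1\le i\le n-1$, let $L(H)=\operatorname{aff}(H)-h^1$, and $M(b)=\{y\in L(H): b\cdot y=0\}$ for $b\in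 L(H)\setminus\{0\}$. Choose $b^1,\dots,b^L\in L(H)\setminus\{0\}$, one for each linear hyperplane of $L(H)$ spanned by a subset of $\{c^1,\dots,c^{n-1}\}$, such that $M(b^1),\dots,M(b^L)$ are exactly these hyperplanes. Then $\operatorname{size}_G(Q(\mathcal{P},H))$ is the number of the general inequalities $$\sum_{j=1}^{n+1}\min\{b^l\cdot h^j,b^l\cdot h^{j-1}\}\lambda_j\le b^l\cdot y\le\sum_{j=1}^{n+1}\max\{b^l\cdot h^j,b^l\cdot h^{j-1}\}\lambda_j,\qquad l=1,\dots,L$$ (inequalities with the same solution set counted once), and $\operatorname{size}_B(Q(\mathcal{P},H))$ is the number of the variable bounds $\lambda_j\ge 0$, $j\in J$, where $$J=\{1,n+1\}\cup\bigl\{j\in\{2,\dots,n\}: L(H)=\operatorname{span}\{c^i: 1\le i\le n-1,\ i\ne j-1\}\bigr\}.$$ *Result.* Let $H$ be the unary encoding, i.e. $k=n$ and $h^i=\mathbf{e}^i$ is the $i$-th unit vector. Then for all $\lambda\in\mathbb{R}^{n+1}$ and $y\in\mathbb{R}^n$, $(\lambda,y)\in Q(\mathcal{P},H)$ if and only if $$\sum_{j=1}^{n+1}\lambda_j=1,\qquad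 \sum_{i=1}^n y_i=1,\tag{1}$$ $$\sum_{j=l+2}^{n+1}\lambda_j\le\sum_{i=l+1}^n y_i,\qquad \sum_{j=1}^{l}\lambda_j\le\sum_{i=1}^l y_i\qquad\text{for all } l\in\{1,\dots,n-1\},\tag{2}$$ $$\lambda_1\ge 0,\qquad \lambda_{n+1}\ge 0.\tag{3}$$ Furthermore, each inequality in (2) and (3) is facet defining for $Q(\mathcal{P},H)$ (it is valid for $Q(\mathcal{P},H)$ and the face on which it holds with equality is nonempty and of dimension $\dim Q(\mathcal{P},H)-1$), and $$\operatorname{size}(Q(\mathcal{P},H))=2n+4,\qquad \operatorname{size}_G(Q(\mathcal{P},H))=2(n-1),\qquad \operatorname{size}_B(Q(\mathcal{P},H))=2 .$$ -/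

import Mathlib

open scoped Matrix

/-! ### Polyhedral notions in a finite-dimensional real vector space -/

section Polyhedra

variable {E : Type*} [AddCommGroup E] [Module ℝ E] [FiniteDimensional ℝ E]

/-- The dimension of a (nonempty) set: the dimension of its affine hull. -/
noncomputable def affDim (S : Set E) : ℕ :=
  Module.finrank ℝ (affineSpan ℝ S).direction

/-- The linear inequality `f x ≤ β` is facet defining for `Q`: it is valid for `Q`, and the face of
`Q` on which it holds with equality is nonempty and has dimension `dim Q - 1`. -/
def IsFacetDefining (Q : Set E) (f : E →ₗ[ℝ] ℝ) (β : ℝ) : Prop :=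
  (∀ x ∈ Q, f x ≤ β) ∧ {x ∈ Q | f x = β}.Nonempty ∧
    affDim {x ∈ Q | f x = β} + 1 = affDim Q

/-- `Q` is the solution set of a system of `e` linear equations and `m` linear inequalities, in
which no inequality is an equation in disguise: each inequality is strict at some point of `Q`. -/
def HasLinearDescription (Q : Set E) (e m : ℕ) : Prop :=
  ∃ (a : Fin e → E →ₗ[ℝ] ℝ) (α : Fin e → ℝ) (f : Fin m → E →ₗ[ℝ] ℝ) (β : Fin m → ℝ),
    Q = {x | (∀ s, a s x = α s) ∧ (∀ t, f t x ≤ β t)} ∧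
    ∀ t, ∃ x ∈ Q, f t x < β t

/-- The size of a polyhedron: the minimum number of linear inequalities in a linear description of
it, where each equation is counted as two inequalities. -/
noncomputable def polySize (Q : Set E) : ℕ :=
  sInf {N | ∃ e m : ℕ, HasLinearDescription Q e m ∧ N = 2 * e + m}

end Polyhedra

/-! ### Embeddings of a family of polyhedra and the SOS2 constraint

Vectors are indexed from `0`: the entry `λ_j` is `lam (j - 1)`, and `h^i` is `H (i - 1)`. -/

/-- The convex hull of the union of the sets `P^i × {h^i}`. -/
def embeddingHull {d n k : ℕ} (P : Fin n → Set (Fin d → ℝ)) (H : Fin n → Fin k → ℝ) :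
    Set ((Fin d → ℝ) × (Fin k → ℝ)) :=
  convexHull ℝ (⋃ i, P i ×ˢ {H i})

/-- The SOS2 constraint on the standard simplex in `ℝ^(n+1)`: the `i`-th polyhedron consists of the
points of the simplex whose entries other than `i` and `i + 1` are at most zero. -/
def sos2 (n : ℕ) (i : Fin n) : Set (Fin (n + 1) → ℝ) :=
  {lam | lam ∈ stdSimplex ℝ (Fin (n + 1)) ∧
    ∀ j, j ∉ ({i.castSucc, i.succ} : Set (Fin (n + 1))) → lam j ≤ 0}

/-- The unary encoding: `h^i` is the `i`-th unit vector of `ℝ^n`. -/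
def unaryEncoding (n : ℕ) (i : Fin n) : Fin n → ℝ := Pi.single i 1

/-! ### General inequalities and variable bounds for the SOS2 constraint with encoding `H` -/

section Sizes

variable {n k : ℕ} [NeZero n]

/-- The vector `h^m` for `0 ≤ m ≤ n + 1` (counted from one), with `h^0 = h^1` and
`h^(n+1) = h^n`. -/
def code (H : Fin n → Fin k → ℝ) (m : ℕ) : Fin k → ℝ :=
  H ⟨min (m - 1) (n - 1), by have := NeZero.pos n; omega⟩

/-- The difference `c^i = h^(i+1) - h^i`, for `1 ≤ i ≤ n - 1`. -/
def codeDiff (H : Fin n → Fin k → ℝ) (i : ℕ) : Fin k → ℝ :=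
  code H (i + 1) - code H i

/-- `L(H)`, the linear space parallel to the affine hull of `H`. -/
def codeSpace (H : Fin n → Fin k → ℝ) : Submodule ℝ (Fin k → ℝ) :=
  (affineSpan ℝ (Set.range H)).direction

/-- `M(b)`, the linear hyperplane of `L(H)` defined by `b`. -/
def codeHyperplane (H : Fin n → Fin k → ℝ) (b : Fin k → ℝ) : Set (Fin k → ℝ) :=
  {y | y ∈ codeSpace H ∧ b ⬝ᵥ y = 0}

/-- `b` is a nonzero vector of `L(H)` and the hyperplane `M(b)` of `L(H)` is spanned by some of the
vectors `c^1, …, c^(n-1)`. -/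
def IsSpannedNormal (H : Fin n → Fin k → ℝ) (b : Fin k → ℝ) : Prop :=
  b ∈ codeSpace H ∧ b ≠ 0 ∧
    ∃ S ⊆ Set.Icc 1 (n - 1),
      codeHyperplane H b = (Submodule.span ℝ (codeDiff H '' S) : Set (Fin k → ℝ))

/-- The general inequalities
`∑ j, min (b · h^j) (b · h^(j-1)) * λ_j ≤ b · y` and
`b · y ≤ ∑ j, max (b · h^j) (b · h^(j-1)) * λ_j`, for the spanned hyperplanes `M(b)`.
An inequality is represented by the half-space of its solutions, so that the normals `s • b`,
`s ≠ 0`, of one hyperplane together contribute one pair of inequalities. -/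
def generalInequalities (H : Fin n → Fin k → ℝ) :
    Set (Set ((Fin (n + 1) → ℝ) × (Fin k → ℝ))) :=
  {W | ∃ b, IsSpannedNormal H b ∧
    (W = {p | ∑ j : Fin (n + 1),
            min (b ⬝ᵥ code H ((j : ℕ) + 1)) (b ⬝ᵥ code H (j : ℕ)) * p.1 j ≤ b ⬝ᵥ p.2} ∨
      W = {p | b ⬝ᵥ p.2 ≤ ∑ j : Fin (n + 1),
            max (b ⬝ᵥ code H ((j : ℕ) + 1)) (b ⬝ᵥ code H (j : ℕ)) * p.1 j})}

/-- The index set `J` (counted from one) of the variable bounds. -/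
def boundIndices (H : Fin n → Fin k → ℝ) : Set ℕ :=
  {1, n + 1} ∪ {j | j ∈ Set.Icc 2 n ∧
    codeSpace H = Submodule.span ℝ (codeDiff H '' (Set.Icc 1 (n - 1) \ {j - 1}))}

/-- The variable bounds `λ_j ≥ 0` for `j ∈ J`, represented by half-spaces. -/
def boundInequalities (H : Fin n → Fin k → ℝ) :
    Set (Set ((Fin (n + 1) → ℝ) × (Fin k → ℝ))) :=
  {W | ∃ j : Fin (n + 1), (j : ℕ) + 1 ∈ boundIndices H ∧ W = {p | 0 ≤ p.1 j}}

/-- The number of general inequalities. -/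
noncomputable def sizeG (H : Fin n → Fin k → ℝ) : ℕ := (generalInequalities H).ncard

/-- The number of variable bounds. -/
noncomputable def sizeB (H : Fin n → Fin k → ℝ) : ℕ := (boundInequalities H).ncard

end Sizes

/-! ### Coordinates of `(λ, y)` as linear functionals -/

/-- The coordinate functional `(λ, y) ↦ λ_j`. -/
def lamCoord {d k : ℕ} (j : Fin d) : ((Fin d → ℝ) × (Fin k → ℝ)) →ₗ[ℝ] ℝ :=
  LinearMap.proj j ∘ₗ LinearMap.fst ℝ (Fin d → ℝ) (Fin k → ℝ)

/-- The coordinate functional `(λ, y) ↦ y_i`. -/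
def yCoord {d k : ℕ} (i : Fin k) : ((Fin d → ℝ) × (Fin k → ℝ)) →ₗ[ℝ] ℝ :=
  LinearMap.proj i ∘ₗ LinearMap.snd ℝ (Fin d → ℝ) (Fin k → ℝ)

/-! ### Simplices given by vertices and biorthogonal functionals -/

section Simplex

variable {E ι : Type*} [AddCommGroup E] [Module ℝ E] [Fintype ι]

/-! Each `P^i` is the segment from `e_i` to `e_(i+1)`, so the embedding is the hull of the `2n`
points `(e_i, h^i)` and `(e_(i+1), h^i)`. The gaps between the two sides of (2), extended to `l = 0`
and `l = n`, form a family of functionals biorthogonal to these points (`sos2Gap_sos2Vertex`). Hence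
the points are linearly independent and the embedding is a simplex. Its barycentric coordinates are
the gaps, and the two extra gaps equal `λ_1` and `λ_(n+1)` wherever `∑ y = ∑ λ`. This gives the
description and the facets. A simplex needs one inequality per facet and at least as many equations
as its codimension, here 2, so the size is `2 * 2 + 2n` (`polySize_convexHull_range`).

For the general inequalities, the `c^i` form a basis of `L(H)`, the space of vectors with entry sum
zero, with the negated partial sums as dual functionals. A hyperplane spanned by some of them is
therefore spanned by all but one (`isSpannedNormal_unaryEncoding_iff`). This leaves `n - 1`
hyperplanes, whose inequalities reduce to (2) on `∑ y = ∑ λ`. Since no `c^i` is redundant in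
spanning `L(H)`, only the two outer variable bounds remain. -/

theorem mem_convexHull_range_iff_exists_sum {v : ι → E} {x : E} :
    x ∈ convexHull ℝ (Set.range v) ↔
      ∃ w : ι → ℝ, (∀ i, 0 ≤ w i) ∧ ∑ i, w i = 1 ∧ ∑ i, w i • v i = x := by
  classical
  -- Taking convex hulls commutes with linear maps, and the hull of the standard basis is the
  -- standard simplex.
  have h : Set.range v = Fintype.linearCombination ℝ v ''
      Set.range fun i j : ι => if i = j then (1 : ℝ) else 0 := by
    rw [← Set.range_comp]
    congr 1
    ext i
    simp [Fintype.linearCombination_apply]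
  rw [h, ← LinearMap.image_convexHull, convexHull_basis_eq_stdSimplex]
  simp [stdSimplex, Fintype.linearCombination_apply, and_assoc]

theorem linearIndependent_of_biorthogonal [DecidableEq ι] {v : ι → E} {g : ι → E →ₗ[ℝ] ℝ}
    (hg : ∀ i j, g i (v j) = if i = j then 1 else 0) : LinearIndependent ℝ v := by
  rw [Fintype.linearIndependent_iff]
  intro w hw i
  simpa [map_sum, hg] using congrArg (g i) hw

theorem apply_nonneg_of_mem_convexHull [DecidableEq ι] {v : ι → E} {g : ι → E →ₗ[ℝ] ℝ}
    (hg : ∀ i j, g i (v j) = if i = j then 1 else 0) {x : E}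
    (hx : x ∈ convexHull ℝ (Set.range v)) (i : ι) : 0 ≤ g i x := by
  obtain ⟨w, hw, -, rfl⟩ := mem_convexHull_range_iff_exists_sum.1 hx
  simpa [map_sum, hg] using hw i

/-- Moving a little from a point strictly inside finitely many half-spaces keeps it inside. -/
theorem exists_pos_forall_add_mul_le {τ : Type*} [Finite τ] {c β : τ → ℝ} (d : τ → ℝ)
    (h : ∀ t, c t < β t) : ∃ ε > 0, ∀ t, c t + ε * d t ≤ β t := by
  have key : ∀ᶠ ε in nhdsWithin (0 : ℝ) (Set.Ioi 0), ∀ t, c t + ε * d t ≤ β t := by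
    rw [Filter.eventually_all]
    intro t
    have hc : Filter.Tendsto (fun ε : ℝ => c t + ε * d t) (nhdsWithin 0 (Set.Ioi 0))
        (nhds (c t + 0 * d t)) :=
      (Continuous.tendsto (by fun_prop) 0).mono_left nhdsWithin_le_nhds
    exact (hc.eventually_lt_const (by simpa using h t)).mono fun _ => le_of_lt
  obtain ⟨ε, h1, h2⟩ := (key.and self_mem_nhdsWithin).exists
  exact ⟨ε, h2, h1⟩

theorem affDim_convexHull_range {v : ι → E} (hv : AffineIndependent ℝ v) {d : ℕ}
    (hd : Fintype.card ι = d + 1) : affDim (convexHull ℝ (Set.range v)) = d := by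
  rw [affDim, affineSpan_convexHull, direction_affineSpan, hv.finrank_vectorSpan hd]

/-- A linear functional which is maximal on all but one vertex of a simplex defines a facet. -/
theorem isFacetDefining_convexHull_range {v : ι → E} (hv : AffineIndependent ℝ v)
    (hcard : 2 ≤ Fintype.card ι) {f : E →ₗ[ℝ] ℝ} {β : ℝ} {i : ι} (hi : f (v i) < β)
    (hne : ∀ j, j ≠ i → f (v j) = β) : IsFacetDefining (convexHull ℝ (Set.range v)) f β := by
  classical
  have hle : ∀ j, f (v j) ≤ β := fun j => by
    by_cases h : j = i
    · exact h ▸ hi.le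
    · exact (hne j h).le
  have hface : {x ∈ convexHull ℝ (Set.range v) | f x = β} =
      convexHull ℝ (Set.range fun j : {j // j ≠ i} => v j) := by
    apply Set.Subset.antisymm
    · rintro x ⟨hx, hfx⟩
      obtain ⟨w, hw0, hw1, rfl⟩ := mem_convexHull_range_iff_exists_sum.1 hx
      -- The weighted average of the slacks `β - f (v j)` is zero, and only vertex `i` has nonzero
      -- slack.
      have hwi : w i = 0 := by
        have h1 : ∑ j, w j * (β - f (v j)) = 0 := by
          simp only [map_sum, map_smul, smul_eq_mul] at hfx
          simp only [mul_sub, Finset.sum_sub_distrib, hfx, ← Finset.sum_mul, hw1]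
          ring
        rw [Finset.sum_eq_single i (fun j _ hj => by simp [hne j hj]) (by simp)] at h1
        exact (mul_eq_zero.1 h1).resolve_right (sub_pos.2 hi).ne'
      refine mem_convexHull_range_iff_exists_sum.2 ⟨fun j => w j, fun j => hw0 j, ?_, ?_⟩
      · rw [← hw1, Fintype.sum_eq_add_sum_subtype_ne w i, hwi, zero_add]
      · rw [Fintype.sum_eq_add_sum_subtype_ne (fun j => w j • v j) i, hwi, zero_smul, zero_add]
    · intro x hx
      refine ⟨convexHull_mono (by rintro _ ⟨j, rfl⟩; exact ⟨j, rfl⟩) hx, ?_⟩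
      obtain ⟨w, hw0, hw1, rfl⟩ := mem_convexHull_range_iff_exists_sum.1 hx
      simp only [map_sum, map_smul, smul_eq_mul]
      rw [Finset.sum_congr rfl fun j _ => by rw [hne j j.2], ← Finset.sum_mul, hw1, one_mul]
  obtain ⟨d, hd⟩ : ∃ d, Fintype.card ι = d + 2 := ⟨_, (Nat.sub_add_cancel hcard).symm⟩
  have hsub : Fintype.card {j // j ≠ i} = d + 1 := by
    rw [Fintype.card_subtype_compl, Fintype.card_subtype_eq]; omega
  refine ⟨fun x hx => ?_, ?_, ?_⟩
  · obtain ⟨w, hw0, hw1, rfl⟩ := mem_convexHull_range_iff_exists_sum.1 hx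
    calc f (∑ j, w j • v j) = ∑ j, w j * f (v j) := by simp
      _ ≤ ∑ j, w j * β := Finset.sum_le_sum fun j _ => mul_le_mul_of_nonneg_left (hle j) (hw0 j)
      _ = β := by rw [← Finset.sum_mul, hw1, one_mul]
  · obtain ⟨j⟩ : Nonempty {j // j ≠ i} := Fintype.card_pos_iff.1 (by omega)
    exact ⟨v j, subset_convexHull _ _ ⟨j, rfl⟩, hne j j.2⟩
  · have hv' : AffineIndependent ℝ fun j : {j // j ≠ i} => v j :=
      hv.comp_embedding (Function.Embedding.subtype _)
    rw [hface, affDim_convexHull_range hv' hsub, affDim_convexHull_range hv hd]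

/-! ### Lower bounds on the size of a linear description -/

variable [FiniteDimensional ℝ E]

/-- If every inequality of a linear description is strict at a common point `p`, then the number of
equations is at least the codimension. -/
theorem finrank_le_add_affDim {Q : Set E} {e m : ℕ} {a : Fin e → E →ₗ[ℝ] ℝ} {α : Fin e → ℝ}
    {f : Fin m → E →ₗ[ℝ] ℝ} {β : Fin m → ℝ}
    (hQ : Q = {x | (∀ s, a s x = α s) ∧ ∀ t, f t x ≤ β t}) {p : E} (hp : p ∈ Q)
    (hlt : ∀ t, f t p < β t) : Module.finrank ℝ E ≤ e + affDim Q := by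
  -- A short step from `p` along a direction killed by all equations stays in `Q`. The space of
  -- these directions has codimension at most `e`.
  have hker : LinearMap.ker (LinearMap.pi a) ≤ (affineSpan ℝ Q).direction := by
    intro w hw
    have hw' : ∀ s, a s w = 0 := fun s => congrFun (LinearMap.mem_ker.1 hw) s
    obtain ⟨ε, hε, h⟩ := exists_pos_forall_add_mul_le (fun t => f t w) hlt
    have hmem : p + ε • w ∈ Q := by
      have hp' := hp
      rw [hQ] at hp' ⊢
      exact ⟨fun s => by simp [hw', hp'.1 s], fun t => by simpa using h t⟩
    have := AffineSubspace.vsub_mem_direction (subset_affineSpan ℝ Q hmem)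
      (subset_affineSpan ℝ Q hp)
    rw [vsub_eq_sub, add_sub_cancel_left] at this
    exact (Submodule.smul_mem_iff _ hε.ne').1 this
  have h1 := LinearMap.finrank_range_add_finrank_ker (LinearMap.pi a)
  have h2 := Submodule.finrank_mono hker
  have h3 := Submodule.finrank_le (LinearMap.range (LinearMap.pi a))
  rw [Module.finrank_fin_fun] at h3
  rw [affDim]
  omega

/-- The size of a simplex: no linear description is smaller than the one by its affine hull and its
facets. -/
theorem polySize_convexHull_range [DecidableEq ι] {v : ι → E} {g : ι → E →ₗ[ℝ] ℝ}
    (hg : ∀ i j, g i (v j) = if i = j then 1 else 0) (hcard : 2 ≤ Fintype.card ι) {e : ℕ}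
    {a : Fin e → E →ₗ[ℝ] ℝ} {α : Fin e → ℝ}
    (hQ : convexHull ℝ (Set.range v) = {x | (∀ s, a s x = α s) ∧ ∀ i, 0 ≤ g i x})
    (he : Module.finrank ℝ E + 1 = e + Fintype.card ι) :
    polySize (convexHull ℝ (Set.range v)) = 2 * e + Fintype.card ι := by
  have hmem : ∀ i, v i ∈ convexHull ℝ (Set.range v) := fun i => subset_convexHull _ _ ⟨i, rfl⟩
  set N := Fintype.card ι with hN
  apply IsLeast.csInf_eq
  constructor
  · let φ := Fintype.equivFin ι
    refine ⟨e, N, ⟨a, α, fun t => -g (φ.symm t), fun _ => 0, ?_, fun t => ?_⟩, rfl⟩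
    · rw [hQ]
      ext x
      simp only [Set.mem_ofPred_eq, LinearMap.neg_apply, neg_nonpos]
      exact and_congr_right fun _ => ⟨fun h t => h _, fun h i => by simpa using h (φ i)⟩
    · exact ⟨v (φ.symm t), hmem _, by simp [hg]⟩
  · rintro _ ⟨e', m, ⟨a', α', f, β, hQ', hstrict⟩, rfl⟩
    have hNpos : (0 : ℝ) < N := by exact_mod_cast (by omega : 0 < N)
    have hv : ∀ i, (∀ s, a' s (v i) = α' s) ∧ ∀ t, f t (v i) ≤ β t := fun i => by
      have := hmem i
      rw [hQ'] at this
      exact this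
    -- An inequality tight at every vertex would be tight on all of the simplex.
    have hvert : ∀ t, ∃ i, f t (v i) < β t := by
      intro t
      by_contra! h
      obtain ⟨x, hx, hlt⟩ := hstrict t
      obtain ⟨w, hw0, hw1, rfl⟩ := mem_convexHull_range_iff_exists_sum.1 hx
      refine hlt.not_ge ?_
      calc β t = ∑ j, w j * β t := by rw [← Finset.sum_mul, hw1, one_mul]
        _ ≤ ∑ j, w j * f t (v j) :=
          Finset.sum_le_sum fun j _ => mul_le_mul_of_nonneg_left (h j) (hw0 j)
        _ = f t (∑ j, w j • v j) := by simp
    have h1 : e ≤ e' := by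
      -- The centroid gives every vertex positive weight, so all inequalities are strict there at
      -- once.
      have hp : ∑ i, (N : ℝ)⁻¹ • v i ∈ convexHull ℝ (Set.range v) :=
        mem_convexHull_range_iff_exists_sum.2
          ⟨fun _ => (N : ℝ)⁻¹, fun _ => by positivity, by simp [← hN, hNpos.ne'], rfl⟩
      have hlt : ∀ t, f t (∑ i, (N : ℝ)⁻¹ • v i) < β t := by
        intro t
        obtain ⟨i, hi⟩ := hvert t
        calc f t (∑ i, (N : ℝ)⁻¹ • v i) = ∑ i, (N : ℝ)⁻¹ * f t (v i) := by simp
          _ < ∑ i : ι, (N : ℝ)⁻¹ * β t :=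
            Finset.sum_lt_sum (fun j _ => by gcongr; exact (hv j).2 t)
              ⟨i, Finset.mem_univ _, by gcongr⟩
          _ = β t := by simp [← hN, hNpos.ne']
      have := finrank_le_add_affDim hQ' hp hlt
      rw [affDim_convexHull_range (linearIndependent_of_biorthogonal hg).affineIndependent
        (d := N - 1) (by omega)] at this
      omega
    have h2 : N ≤ m := by
      -- Each facet needs an inequality tight on it. Otherwise all inequalities are strict at the
      -- facet's centroid `x`, and moving from `x` away from `v i` stays in the simplex while `g i`
      -- drops from 0 to `-ε`.
      have hex : ∀ i, ∃ t, ∀ j, j ≠ i → f t (v j) = β t := by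
        intro i
        let M : ℝ := ((Finset.univ.erase i).card : ℝ)
        have hM : 0 < M := by
          have : (Finset.univ.erase i).card = N - 1 := by
            rw [Finset.card_erase_of_mem (Finset.mem_univ i), Finset.card_univ]
          simp only [M, this]
          exact_mod_cast (by omega : 0 < N - 1)
        let x : E := ∑ j ∈ Finset.univ.erase i, M⁻¹ • v j
        by_contra! hcon
        have hlt : ∀ t, f t x < β t := by
          intro t
          obtain ⟨j, hji, hj⟩ := hcon t
          calc f t x = ∑ j ∈ Finset.univ.erase i, M⁻¹ * f t (v j) := by simp [x]
            _ < ∑ j ∈ Finset.univ.erase i, M⁻¹ * β t :=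
              Finset.sum_lt_sum (fun k _ => by gcongr; exact (hv k).2 t)
                ⟨j, by simp [hji], mul_lt_mul_of_pos_left (lt_of_le_of_ne ((hv j).2 t) hj)
                  (by positivity)⟩
            _ = β t := by
              rw [Finset.sum_const, nsmul_eq_mul, ← mul_assoc]
              change M * M⁻¹ * β t = β t
              rw [mul_inv_cancel₀ hM.ne', one_mul]
        have hax : ∀ s, a' s x = α' s := by
          intro s
          calc a' s x = ∑ j ∈ Finset.univ.erase i, M⁻¹ * α' s := by
                simp only [x, map_sum, map_smul, smul_eq_mul, fun j => (hv j).1 s]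
            _ = α' s := by
              rw [Finset.sum_const, nsmul_eq_mul, ← mul_assoc]
              change M * M⁻¹ * α' s = α' s
              rw [mul_inv_cancel₀ hM.ne', one_mul]
        obtain ⟨ε, hε, h⟩ := exists_pos_forall_add_mul_le (fun t => f t (x - v i)) hlt
        have hin : x + ε • (x - v i) ∈ convexHull ℝ (Set.range v) := by
          rw [hQ']
          exact ⟨fun s => by simp [hax, (hv i).1 s], fun t => by simpa using h t⟩
        have hnn := apply_nonneg_of_mem_convexHull hg hin i
        have hgx : g i x = 0 := by
          simp only [x, map_sum, map_smul, hg]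
          exact Finset.sum_eq_zero fun j hj => by simp [(Finset.ne_of_mem_erase hj).symm]
        simp only [map_add, map_smul, map_sub, hgx, hg, smul_eq_mul, if_true] at hnn
        linarith
      choose T hT using hex
      -- An inequality serving two facets would be tight at every vertex, against `hvert`.
      have hinj : Function.Injective T := by
        intro i j hij
        by_contra hne
        obtain ⟨k, hk⟩ := hvert (T i)
        by_cases hki : k = i
        · exact hk.ne (hij ▸ hT j k (hki ▸ hne))
        · exact hk.ne (hT i k hki)
      simpa using Fintype.card_le_of_injective T hinj
    omega

end Simplex

/-! ### The embedding of the SOS2 constraint with the unary encoding -/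

section UnarySOS2

/-- The functional `∑_{i > m} y_i - ∑_{j > m + 1} λ_j` (entries counted from one). -/
noncomputable def suffixGap (n m : ℕ) : ((Fin (n + 1) → ℝ) × (Fin n → ℝ)) →ₗ[ℝ] ℝ :=
  (∑ i : Fin n with m + 1 ≤ i.val + 1, yCoord i)
    - ∑ j : Fin (n + 1) with m + 2 ≤ j.val + 1, lamCoord j

/-- The functional `∑_{i ≤ m} y_i - ∑_{j ≤ m} λ_j` (entries counted from one). -/
noncomputable def prefixGap (n m : ℕ) : ((Fin (n + 1) → ℝ) × (Fin n → ℝ)) →ₗ[ℝ] ℝ :=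
  (∑ i : Fin n with i.val + 1 ≤ m, yCoord i)
    - ∑ j : Fin (n + 1) with j.val + 1 ≤ m, lamCoord j

/-- The points `(e_i, h^i)` and `(e_(i+1), h^i)`. -/
noncomputable def sos2Vertex (n : ℕ) : Fin n ⊕ Fin n → (Fin (n + 1) → ℝ) × (Fin n → ℝ) :=
  Sum.elim (fun i => (Pi.single i.castSucc 1, unaryEncoding n i))
    (fun i => (Pi.single i.succ 1, unaryEncoding n i))

/-- The functionals that are biorthogonal to `sos2Vertex`. -/
noncomputable def sos2Gap (n : ℕ) :
    Fin n ⊕ Fin n → ((Fin (n + 1) → ℝ) × (Fin n → ℝ)) →ₗ[ℝ] ℝ :=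
  Sum.elim (fun i => suffixGap n i) (fun i => prefixGap n (i + 1))

variable {n : ℕ}

/-! ### Gaps as barycentric coordinates -/

theorem suffixGap_apply (m : ℕ) (p : (Fin (n + 1) → ℝ) × (Fin n → ℝ)) :
    suffixGap n m p = (∑ i : Fin n with m + 1 ≤ i.val + 1, p.2 i)
      - ∑ j : Fin (n + 1) with m + 2 ≤ j.val + 1, p.1 j := by
  simp [suffixGap, yCoord, lamCoord]

theorem prefixGap_apply (m : ℕ) (p : (Fin (n + 1) → ℝ) × (Fin n → ℝ)) :
    prefixGap n m p = (∑ i : Fin n with i.val + 1 ≤ m, p.2 i)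
      - ∑ j : Fin (n + 1) with j.val + 1 ≤ m, p.1 j := by
  simp [prefixGap, yCoord, lamCoord]

/-- Counted from zero, the `y`-sum sees positions at least `m` and the `λ`-sum positions at least `m
+ 1`. With both ones at position `i`, the sums differ only for `i = m`; with the `λ`-one shifted to
`i + 1` they always agree. -/
theorem suffixGap_inl (m : ℕ) (i : Fin n) :
    suffixGap n m (sos2Vertex n (Sum.inl i)) = if m = i then 1 else 0 := by
  simp only [suffixGap_apply, sos2Vertex, Sum.elim_inl, unaryEncoding, Finset.sum_pi_single',
    Finset.mem_filter, Finset.mem_univ, true_and, Fin.val_castSucc]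
  split_ifs <;> first | omega | norm_num

theorem suffixGap_inr (m : ℕ) (i : Fin n) : suffixGap n m (sos2Vertex n (Sum.inr i)) = 0 := by
  simp only [suffixGap_apply, sos2Vertex, Sum.elim_inr, unaryEncoding, Finset.sum_pi_single',
    Finset.mem_filter, Finset.mem_univ, true_and, Fin.val_succ]
  split_ifs <;> first | omega | norm_num

theorem prefixGap_inl (m : ℕ) (i : Fin n) : prefixGap n m (sos2Vertex n (Sum.inl i)) = 0 := by
  simp only [prefixGap_apply, sos2Vertex, Sum.elim_inl, unaryEncoding, Finset.sum_pi_single',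
    Finset.mem_filter, Finset.mem_univ, true_and, Fin.val_castSucc]
  split_ifs <;> first | omega | norm_num

theorem prefixGap_inr (m : ℕ) (i : Fin n) :
    prefixGap n m (sos2Vertex n (Sum.inr i)) = if m = i + 1 then 1 else 0 := by
  simp only [prefixGap_apply, sos2Vertex, Sum.elim_inr, unaryEncoding, Finset.sum_pi_single',
    Finset.mem_filter, Finset.mem_univ, true_and, Fin.val_succ]
  split_ifs <;> first | omega | norm_num

theorem sos2Gap_sos2Vertex (s t : Fin n ⊕ Fin n) :
    sos2Gap n s (sos2Vertex n t) = if s = t then 1 else 0 := by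
  rcases s with s | s <;> rcases t with t | t <;>
    simp [sos2Gap, suffixGap_inl, suffixGap_inr, prefixGap_inl, prefixGap_inr, Fin.ext_iff]

theorem affineIndependent_sos2Vertex : AffineIndependent ℝ (sos2Vertex n) :=
  (linearIndependent_of_biorthogonal sos2Gap_sos2Vertex).affineIndependent

theorem sum_filter_add_sum_filter_add_one {k : ℕ} (f : Fin k → ℝ) (j : Fin k) :
    (∑ i with i.val + 1 ≤ j.val, f i) + f j + ∑ i with j.val + 2 ≤ i.val + 1, f i = ∑ i, f i := by
  rw [Finset.sum_filter, Finset.sum_filter,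
    ← Fintype.sum_ite_eq j f, ← Finset.sum_add_distrib, ← Finset.sum_add_distrib]
  refine Finset.sum_congr rfl fun i _ => ?_
  split_ifs <;> first | omega | simp_all

theorem sum_filter_le_add_sum_filter_lt {k : ℕ} (f : Fin k → ℝ) (m : ℕ) :
    (∑ i with i.val + 1 ≤ m, f i) + ∑ i with m + 1 ≤ i.val + 1, f i = ∑ i, f i := by
  rw [Finset.sum_filter, Finset.sum_filter, ← Finset.sum_add_distrib]
  refine Finset.sum_congr rfl fun i _ => ?_
  split_ifs <;> first | omega | simp

/-- The two `y`-sums cover every index once, while the two `λ`-sums leave out exactly `λ_j`. -/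
theorem suffixGap_add_prefixGap {p : (Fin (n + 1) → ℝ) × (Fin n → ℝ)}
    (h : ∑ i, p.2 i = ∑ j, p.1 j) (j : Fin (n + 1)) :
    suffixGap n j p + prefixGap n j p = p.1 j := by
  rw [suffixGap_apply, prefixGap_apply]
  linarith [sum_filter_add_sum_filter_add_one p.1 j, sum_filter_le_add_sum_filter_lt p.2 j]

/-- With the prefix one step longer, the `λ`-sums cover everything once and the `y`-sums count `y_i`
twice. -/
theorem suffixGap_add_prefixGap_succ {p : (Fin (n + 1) → ℝ) × (Fin n → ℝ)}
    (h : ∑ i, p.2 i = ∑ j, p.1 j) (i : Fin n) :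
    suffixGap n i p + prefixGap n (i + 1) p = p.2 i := by
  rw [suffixGap_apply, prefixGap_apply]
  have h1 := sum_filter_add_sum_filter_add_one p.2 i
  have h2 := sum_filter_le_add_sum_filter_lt p.2 (i : ℕ)
  have h3 := sum_filter_le_add_sum_filter_lt p.2 (i + 1 : ℕ)
  have h4 := sum_filter_le_add_sum_filter_lt p.1 (i + 1 : ℕ)
  simp only [add_assoc, one_add_one_eq_two] at *
  linarith

theorem suffixGap_self (p : (Fin (n + 1) → ℝ) × (Fin n → ℝ)) : suffixGap n n p = 0 := by
  rw [suffixGap_apply, Finset.filter_false_of_mem, Finset.filter_false_of_mem] <;> simp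
  omega

theorem prefixGap_zero (p : (Fin (n + 1) → ℝ) × (Fin n → ℝ)) : prefixGap n 0 p = 0 := by
  simp [prefixGap_apply]

/-- This makes the first variable bound the case `l = 0` of the suffix inequalities;
`prefixGap_self` makes the last one the case `l = n` of the prefix inequalities. -/
theorem suffixGap_zero {p : (Fin (n + 1) → ℝ) × (Fin n → ℝ)}
    (h : ∑ i, p.2 i = ∑ j, p.1 j) : suffixGap n 0 p = p.1 0 := by
  simpa [prefixGap_zero] using suffixGap_add_prefixGap h 0

theorem prefixGap_self {p : (Fin (n + 1) → ℝ) × (Fin n → ℝ)}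
    (h : ∑ i, p.2 i = ∑ j, p.1 j) : prefixGap n n p = p.1 (Fin.last n) := by
  simpa [suffixGap_self] using suffixGap_add_prefixGap h (Fin.last n)

/-- Every point with `∑ y = ∑ λ` is the combination of the vertices with the gaps as weights. -/
theorem sum_sos2Gap_smul_sos2Vertex {p : (Fin (n + 1) → ℝ) × (Fin n → ℝ)}
    (h : ∑ i, p.2 i = ∑ j, p.1 j) : ∑ s, sos2Gap n s p • sos2Vertex n s = p := by
  rw [Fintype.sum_sum_type]
  refine Prod.ext (funext fun j => ?_) (funext fun i => ?_)
  · have h1 : ∑ i : Fin n, suffixGap n i p * Pi.single (M := fun _ => ℝ) i.castSucc 1 j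
        = suffixGap n j p := by
      -- The added term at `i = n` vanishes by `suffixGap_self`; for the prefixes it is the term at
      -- `i = 0`.
      trans ∑ i : Fin (n + 1), suffixGap n i p * Pi.single (M := fun _ => ℝ) i 1 j
      · simp [Fin.sum_univ_castSucc (n := n), suffixGap_self]
      · simp [Pi.single_apply]
    have h2 : ∑ i : Fin n, prefixGap n (i + 1) p * Pi.single (M := fun _ => ℝ) i.succ 1 j
        = prefixGap n j p := by
      trans ∑ i : Fin (n + 1), prefixGap n i p * Pi.single (M := fun _ => ℝ) i 1 j
      · simp [Fin.sum_univ_succ (n := n), prefixGap_zero]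
      · simp [Pi.single_apply]
    simp only [sos2Gap, sos2Vertex, Sum.elim_inl, Sum.elim_inr, Prod.fst_add, Prod.fst_sum,
      Prod.smul_fst, Pi.add_apply, Finset.sum_apply, Pi.smul_apply, smul_eq_mul]
    rw [h1, h2, suffixGap_add_prefixGap h]
  · simp only [sos2Gap, sos2Vertex, Sum.elim_inl, Sum.elim_inr, Prod.snd_add, Prod.snd_sum,
      Prod.smul_snd, Pi.add_apply, Finset.sum_apply, Pi.smul_apply, smul_eq_mul, unaryEncoding]
    rw [← suffixGap_add_prefixGap_succ h]
    simp [Pi.single_apply]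

theorem sum_sos2Gap {p : (Fin (n + 1) → ℝ) × (Fin n → ℝ)}
    (h : ∑ i, p.2 i = ∑ j, p.1 j) : ∑ s, sos2Gap n s p = ∑ i, p.2 i := by
  rw [Fintype.sum_sum_type, ← Finset.sum_add_distrib]
  exact Finset.sum_congr rfl fun i _ => suffixGap_add_prefixGap_succ h i

theorem sum_sos2Vertex_fst (s : Fin n ⊕ Fin n) : ∑ j, (sos2Vertex n s).1 j = 1 := by
  rcases s with s | s <;> simp [sos2Vertex]

theorem sum_sos2Vertex_snd (s : Fin n ⊕ Fin n) : ∑ i, (sos2Vertex n s).2 i = 1 := by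
  rcases s with s | s <;> simp [sos2Vertex, unaryEncoding]

theorem mem_convexHull_sos2Vertex_iff {p : (Fin (n + 1) → ℝ) × (Fin n → ℝ)} :
    p ∈ convexHull ℝ (Set.range (sos2Vertex n)) ↔
      (∑ j, p.1 j = 1 ∧ ∑ i, p.2 i = 1) ∧ ∀ s, 0 ≤ sos2Gap n s p := by
  constructor
  · intro hp
    refine ⟨?_, apply_nonneg_of_mem_convexHull sos2Gap_sos2Vertex hp⟩
    obtain ⟨w, -, hw1, rfl⟩ := mem_convexHull_range_iff_exists_sum.1 hp
    constructor
    · simp only [Prod.fst_sum, Prod.smul_fst, Finset.sum_apply, Pi.smul_apply, smul_eq_mul]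
      rw [Finset.sum_comm]
      simp [← Finset.mul_sum, sum_sos2Vertex_fst, hw1]
    · simp only [Prod.snd_sum, Prod.smul_snd, Finset.sum_apply, Pi.smul_apply, smul_eq_mul]
      rw [Finset.sum_comm]
      simp [← Finset.mul_sum, sum_sos2Vertex_snd, hw1]
  · rintro ⟨⟨h1, h2⟩, hnn⟩
    have h : ∑ i, p.2 i = ∑ j, p.1 j := h2.trans h1.symm
    exact mem_convexHull_range_iff_exists_sum.2
      ⟨fun s => sos2Gap n s p, hnn, (sum_sos2Gap h).trans h2, sum_sos2Gap_smul_sos2Vertex h⟩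

/-- A point of `P^i` has only two nonzero entries, and these are its weights on the two vertices
over `h^i`. -/
theorem embeddingHull_sos2_unaryEncoding :
    embeddingHull (sos2 n) (unaryEncoding n) = convexHull ℝ (Set.range (sos2Vertex n)) := by
  apply Set.Subset.antisymm
  · refine convexHull_min ?_ (convex_convexHull ℝ _)
    simp only [Set.iUnion_subset_iff]
    rintro i ⟨lam, y⟩ ⟨⟨⟨hlam0, hlam1⟩, hsupp⟩, rfl⟩
    have hzero : ∀ j, j ≠ i.castSucc → j ≠ i.succ → lam j = 0 := fun j h1 h2 =>
      le_antisymm (hsupp j (by simp [h1, h2])) (hlam0 j)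
    have hne : i.castSucc ≠ i.succ := Fin.castSucc_lt_succ.ne
    have hsum : lam i.castSucc + lam i.succ = 1 := by
      rw [← hlam1]
      exact (Finset.sum_eq_add_of_mem _ _ (Finset.mem_univ _) (Finset.mem_univ _) hne
        fun j _ hj => hzero j hj.1 hj.2).symm
    have hmem := (convex_convexHull ℝ (Set.range (sos2Vertex n)))
      (subset_convexHull _ _ ⟨Sum.inl i, rfl⟩) (subset_convexHull _ _ ⟨Sum.inr i, rfl⟩)
      (hlam0 i.castSucc) (hlam0 i.succ) hsum
    convert hmem using 1
    refine Prod.ext (funext fun j => ?_) ?_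
    · by_cases h1 : j = i.castSucc
      · subst h1; simp [sos2Vertex, hne]
      · by_cases h2 : j = i.succ
        · subst h2; simp [sos2Vertex, hne]
        · simp [sos2Vertex, h1, h2, hzero]
    · simp [sos2Vertex, ← add_smul, hsum]
  · refine convexHull_mono ?_
    rintro _ ⟨i | i, rfl⟩ <;> refine Set.mem_iUnion.2 ⟨i, ⟨⟨?_, fun j hj => ?_⟩, rfl⟩⟩
    · exact single_mem_stdSimplex ℝ _
    · have : j ≠ i.castSucc := fun h => hj (by simp [h])
      simp [sos2Vertex, this]
    · exact single_mem_stdSimplex ℝ _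
    · have : j ≠ i.succ := fun h => hj (by simp [h])
      simp [sos2Vertex, this]

theorem forall_sos2Gap_nonneg_iff [NeZero n] {p : (Fin (n + 1) → ℝ) × (Fin n → ℝ)}
    (h : ∑ i, p.2 i = ∑ j, p.1 j) : (∀ s, 0 ≤ sos2Gap n s p) ↔
      (∀ l ∈ Finset.Icc 1 (n - 1), 0 ≤ suffixGap n l p ∧ 0 ≤ prefixGap n l p) ∧
        0 ≤ p.1 0 ∧ 0 ≤ p.1 (Fin.last n) := by
  have hn := NeZero.pos n
  rw [← suffixGap_zero h, ← prefixGap_self h]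
  constructor
  · intro hnn
    have hs : ∀ m < n, 0 ≤ suffixGap n m p := fun m hm => hnn (Sum.inl ⟨m, hm⟩)
    have hp : ∀ m < n, 0 ≤ prefixGap n (m + 1) p := fun m hm => hnn (Sum.inr ⟨m, hm⟩)
    refine ⟨fun l hl => ?_, hs 0 hn, ?_⟩
    · rw [Finset.mem_Icc] at hl
      refine ⟨hs l (by omega), ?_⟩
      have := hp (l - 1) (by omega)
      rwa [Nat.sub_add_cancel hl.1] at this
    · have := hp (n - 1) (by omega)
      rwa [Nat.sub_add_cancel hn] at this
  · rintro ⟨hl, h0, h1⟩ (⟨i, hi⟩ | ⟨i, hi⟩)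
    · rcases Nat.eq_zero_or_pos i with rfl | hpos
      · exact h0
      · exact (hl i (Finset.mem_Icc.2 ⟨hpos, by omega⟩)).1
    · rcases eq_or_ne (i + 1) n with heq | hne
      · change 0 ≤ prefixGap n (i + 1) p
        rwa [heq]
      · exact (hl (i + 1) (Finset.mem_Icc.2 ⟨by omega, by omega⟩)).2

theorem mem_embeddingHull_iff [NeZero n] (lam : Fin (n + 1) → ℝ) (y : Fin n → ℝ) :
    (lam, y) ∈ embeddingHull (sos2 n) (unaryEncoding n) ↔
      (∑ j, lam j = 1 ∧ ∑ i, y i = 1) ∧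
      (∀ l ∈ Finset.Icc 1 (n - 1),
        (∑ j : Fin (n + 1) with l + 2 ≤ j.val + 1, lam j
            ≤ ∑ i : Fin n with l + 1 ≤ i.val + 1, y i) ∧
        (∑ j : Fin (n + 1) with j.val + 1 ≤ l, lam j
            ≤ ∑ i : Fin n with i.val + 1 ≤ l, y i)) ∧
      0 ≤ lam 0 ∧ 0 ≤ lam (Fin.last n) := by
  rw [embeddingHull_sos2_unaryEncoding, mem_convexHull_sos2Vertex_iff]
  refine and_congr_right fun h => ?_
  rw [forall_sos2Gap_nonneg_iff (h.2.trans h.1.symm)]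
  simp only [suffixGap_apply, prefixGap_apply, sub_nonneg]

/-! ### Facets and size of the embedding -/

/-- A functional that agrees with `-sos2Gap n s` on the vertices defines a facet. -/
theorem isFacetDefining_of_forall_eq [NeZero n]
    {f : ((Fin (n + 1) → ℝ) × (Fin n → ℝ)) →ₗ[ℝ] ℝ} (s : Fin n ⊕ Fin n)
    (hf : ∀ t, f (sos2Vertex n t) = -sos2Gap n s (sos2Vertex n t)) :
    IsFacetDefining (embeddingHull (sos2 n) (unaryEncoding n)) f 0 := by
  have hn := NeZero.pos n
  rw [embeddingHull_sos2_unaryEncoding]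
  refine isFacetDefining_convexHull_range affineIndependent_sos2Vertex (i := s) ?_ ?_ ?_
  · simp only [Fintype.card_sum, Fintype.card_fin]; omega
  · simp [hf, sos2Gap_sos2Vertex]
  · intro t ht
    simp [hf, sos2Gap_sos2Vertex, ht.symm]

theorem isFacetDefining_neg_suffixGap [NeZero n] {l : ℕ} (hl : l < n) :
    IsFacetDefining (embeddingHull (sos2 n) (unaryEncoding n)) (-suffixGap n l) 0 :=
  isFacetDefining_of_forall_eq (Sum.inl ⟨l, hl⟩) fun _ => rfl

theorem isFacetDefining_neg_prefixGap [NeZero n] {l : ℕ} (hl : l < n) :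
    IsFacetDefining (embeddingHull (sos2 n) (unaryEncoding n)) (-prefixGap n (l + 1)) 0 :=
  isFacetDefining_of_forall_eq (Sum.inr ⟨l, hl⟩) fun _ => rfl

/-- `lamCoord 0` and `suffixGap n 0` are different functionals that agree where `∑ y = ∑ λ`, in
particular at the vertices. -/
theorem isFacetDefining_neg_lamCoord_zero [NeZero n] :
    IsFacetDefining (embeddingHull (sos2 n) (unaryEncoding n)) (-lamCoord 0) 0 := by
  refine isFacetDefining_of_forall_eq (Sum.inl ⟨0, NeZero.pos n⟩) fun t => ?_
  have h := suffixGap_zero ((sum_sos2Vertex_snd t).trans (sum_sos2Vertex_fst t).symm)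
  simp only [sos2Gap, Sum.elim_inl, h]
  rfl

theorem isFacetDefining_neg_lamCoord_last [NeZero n] :
    IsFacetDefining (embeddingHull (sos2 n) (unaryEncoding n)) (-lamCoord (Fin.last n)) 0 := by
  have hn := NeZero.pos n
  refine isFacetDefining_of_forall_eq (Sum.inr ⟨n - 1, by omega⟩) fun t => ?_
  have h := prefixGap_self ((sum_sos2Vertex_snd t).trans (sum_sos2Vertex_fst t).symm)
  simp only [sos2Gap, Sum.elim_inr, Nat.sub_add_cancel hn, h]
  rfl

/-- A simplex with `2n` vertices in dimension `2n + 1` has codimension 2, matching the two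
equations. -/
theorem polySize_embeddingHull [NeZero n] :
    polySize (embeddingHull (sos2 n) (unaryEncoding n)) = 2 * n + 4 := by
  have hn := NeZero.pos n
  rw [embeddingHull_sos2_unaryEncoding, polySize_convexHull_range sos2Gap_sos2Vertex
    (a := ![∑ j, lamCoord j, ∑ i, yCoord i]) (α := fun _ => 1)]
  · simp only [Fintype.card_sum, Fintype.card_fin]; omega
  · simp only [Fintype.card_sum, Fintype.card_fin]; omega
  · ext p
    rw [mem_convexHull_sos2Vertex_iff]
    simp [Fin.forall_fin_two, lamCoord, yCoord]
  · simp only [Module.finrank_prod, Module.finrank_fin_fun, Fintype.card_sum, Fintype.card_fin]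
    omega

end UnarySOS2

/-! ### General inequalities and variable bounds for the unary encoding -/

section UnarySizes

variable {n : ℕ} [NeZero n]

/-! ### Hyperplanes spanned by code differences -/

theorem dotProduct_code_unaryEncoding (b : Fin n → ℝ) (m : ℕ) :
    b ⬝ᵥ code (unaryEncoding n) m
      = b ⟨min (m - 1) (n - 1), by have := NeZero.pos n; omega⟩ := by
  simp [code, unaryEncoding]

/-- The functional `∑_{i ≤ m} y_i` (entries counted from one). -/
noncomputable def partialSum (n m : ℕ) : (Fin n → ℝ) →ₗ[ℝ] ℝ :=
  ∑ i : Fin n with i.val + 1 ≤ m, LinearMap.proj i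

omit [NeZero n] in
theorem partialSum_apply (m : ℕ) (y : Fin n → ℝ) :
    partialSum n m y = ∑ i : Fin n with i.val + 1 ≤ m, y i := by
  simp [partialSum]

/-- The `m`-th partial sum of `e^(r+1) - e^r` is nonzero only when the cut falls between the two
entries. So the negated partial sums are dual to the `c^r`. -/
theorem partialSum_codeDiff (m : ℕ) {r : ℕ} (hr : r ∈ Set.Icc 1 (n - 1)) :
    partialSum n m (codeDiff (unaryEncoding n) r) = if r = m then -1 else 0 := by
  obtain ⟨h1, h2⟩ := hr
  simp only [codeDiff, code, unaryEncoding, map_sub, partialSum_apply, Finset.sum_pi_single',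
    Finset.mem_filter, Finset.mem_univ, true_and]
  split_ifs <;> first | omega | norm_num

/-- Summation by parts: the vectors `c^i` span the vectors with entry sum zero. -/
theorem sum_neg_partialSum_smul_codeDiff {y : Fin n → ℝ} (hy : ∑ i, y i = 0) :
    ∑ r ∈ Finset.Icc 1 (n - 1), (-partialSum n r y) • codeDiff (unaryEncoding n) r = y := by
  have hn := NeZero.pos n
  ext i
  have hi := i.isLt
  have hc : ∀ r ∈ Finset.Icc 1 (n - 1),
      ((-partialSum n r y) • codeDiff (unaryEncoding n) r) i
        = (if r = i.val + 1 then partialSum n r y else 0)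
          - (if r = i.val then partialSum n r y else 0) := by
    intro r hr
    rw [Finset.mem_Icc] at hr
    simp only [codeDiff, code, unaryEncoding, Pi.smul_apply, Pi.sub_apply, Pi.single_apply,
      smul_eq_mul, Fin.ext_iff]
    split_ifs <;> first | omega | simp
  rw [Finset.sum_apply, Finset.sum_congr rfl hc, Finset.sum_sub_distrib, Finset.sum_ite_eq',
    Finset.sum_ite_eq']
  have h0 : partialSum n 0 y = 0 := by simp [partialSum_apply]
  have hlast : partialSum n n y = 0 := by
    rw [partialSum_apply, Finset.filter_true_of_mem (fun i _ => i.isLt), hy]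
  have e1 : (if i.val + 1 ∈ Finset.Icc 1 (n - 1) then partialSum n (i.val + 1) y else 0)
      = partialSum n (i.val + 1) y := by
    split_ifs with h
    · rfl
    · rw [Finset.mem_Icc] at h
      rw [show i.val + 1 = n by omega, hlast]
  have e2 : (if i.val ∈ Finset.Icc 1 (n - 1) then partialSum n i.val y else 0)
      = partialSum n i.val y := by
    split_ifs with h
    · rfl
    · rw [Finset.mem_Icc] at h
      rw [show i.val = 0 by omega, h0]
  rw [e1, e2, partialSum_apply, partialSum_apply]
  have h1 := sum_filter_add_sum_filter_add_one y i
  have h2 := sum_filter_le_add_sum_filter_lt y (i.val + 1)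
  simp only [add_assoc, one_add_one_eq_two] at *
  linarith

theorem codeDiff_mem_codeSpace {k : ℕ} (H : Fin n → Fin k → ℝ) (r : ℕ) :
    codeDiff H r ∈ codeSpace H :=
  AffineSubspace.vsub_mem_direction (subset_affineSpan ℝ _ ⟨_, rfl⟩)
    (subset_affineSpan ℝ _ ⟨_, rfl⟩)

theorem mem_codeSpace_unaryEncoding {y : Fin n → ℝ} :
    y ∈ codeSpace (unaryEncoding n) ↔ ∑ i, y i = 0 := by
  constructor
  · have hle : codeSpace (unaryEncoding n)
        ≤ LinearMap.ker (∑ i, LinearMap.proj i : (Fin n → ℝ) →ₗ[ℝ] ℝ) := by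
      rw [codeSpace, direction_affineSpan, vectorSpan_def, Submodule.span_le]
      rintro _ ⟨_, ⟨i, rfl⟩, _, ⟨j, rfl⟩, rfl⟩
      simp [unaryEncoding, Finset.sum_sub_distrib]
    intro hy
    simpa using hle hy
  · intro hy
    rw [← sum_neg_partialSum_smul_codeDiff hy]
    exact Submodule.sum_mem _ fun r _ => Submodule.smul_mem _ _ (codeDiff_mem_codeSpace _ r)

theorem partialSum_eq_zero_of_mem_span {S : Set ℕ} (hS : S ⊆ Set.Icc 1 (n - 1)) {m : ℕ}
    (hm : m ∉ S) {y : Fin n → ℝ}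
    (hy : y ∈ Submodule.span ℝ (codeDiff (unaryEncoding n) '' S)) : partialSum n m y = 0 := by
  have hle : Submodule.span ℝ (codeDiff (unaryEncoding n) '' S)
      ≤ LinearMap.ker (partialSum n m) := by
    rw [Submodule.span_le]
    rintro _ ⟨r, hr, rfl⟩
    have hrm : r ≠ m := fun h => hm (h ▸ hr)
    simp [partialSum_codeDiff m (hS hr), hrm]
  exact hle hy

/-- Such a `b` is a combination of the `c^r`, hence orthogonal to itself. -/
theorem eq_zero_of_forall_dotProduct_codeDiff {b : Fin n → ℝ} (hb : ∑ i, b i = 0)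
    (h : ∀ r ∈ Set.Icc 1 (n - 1), b ⬝ᵥ codeDiff (unaryEncoding n) r = 0) : b = 0 := by
  rw [← dotProduct_self_eq_zero]
  nth_rewrite 2 [← sum_neg_partialSum_smul_codeDiff hb]
  rw [dotProduct_sum]
  refine Finset.sum_eq_zero fun r hr => ?_
  rw [dotProduct_smul, h r (by simpa using hr), smul_zero]

/-- The normal, orthogonal to all `c^i` with `i ≠ m`, of a spanned hyperplane. -/
def splitNormal (n m : ℕ) (i : Fin n) : ℝ := if i.val + 1 ≤ m then (m : ℝ) - n else m

theorem splitNormal_dotProduct_codeDiff (m : ℕ) {r : ℕ} (hr : r ∈ Set.Icc 1 (n - 1)) :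
    splitNormal n m ⬝ᵥ codeDiff (unaryEncoding n) r = if r = m then (n : ℝ) else 0 := by
  obtain ⟨h1, h2⟩ := hr
  rw [codeDiff, dotProduct_sub, dotProduct_code_unaryEncoding, dotProduct_code_unaryEncoding,
    splitNormal, splitNormal]
  dsimp only
  split_ifs <;> first | omega | ring

omit [NeZero n] in
theorem sum_splitNormal {m : ℕ} (hm : m ≤ n) : ∑ i, splitNormal n m i = 0 := by
  have h : ∀ i, splitNormal n m i = m - if i.val + 1 ≤ m then (n : ℝ) else 0 := fun i => by
    rw [splitNormal]; split_ifs <;> simp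
  have hcard : (Finset.univ.filter fun i : Fin n => i.val + 1 ≤ m).card = m := by
    simp [Fin.card_filter_val_lt, hm]
  simp only [h, Finset.sum_sub_distrib, ← Finset.sum_filter, Finset.sum_const, hcard]
  simp [mul_comm]

theorem isSpannedNormal_unaryEncoding_iff {b : Fin n → ℝ} :
    IsSpannedNormal (unaryEncoding n) b ↔
      ∃ m ∈ Set.Icc 1 (n - 1), ∃ t : ℝ, t ≠ 0 ∧ b = t • splitNormal n m := by
  have hn := NeZero.pos n
  have hn' : (n : ℝ) ≠ 0 := by exact_mod_cast hn.ne'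
  constructor
  · rintro ⟨hbL, hb0, S, hS, hspan⟩
    have hsum := mem_codeSpace_unaryEncoding.1 hbL
    have hmem : ∀ y, y ∈ codeSpace (unaryEncoding n) → b ⬝ᵥ y = 0 →
        y ∈ Submodule.span ℝ (codeDiff (unaryEncoding n) '' S) := fun y h1 h2 => by
      have : y ∈ codeHyperplane (unaryEncoding n) b := ⟨h1, h2⟩
      rwa [hspan] at this
    have hS0 : ∀ r ∈ S, b ⬝ᵥ codeDiff (unaryEncoding n) r = 0 := fun r hr => by
      have : codeDiff (unaryEncoding n) r ∈ codeHyperplane (unaryEncoding n) b := by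
        rw [hspan]
        exact Submodule.subset_span ⟨r, hr, rfl⟩
      exact this.2
    obtain ⟨m, hm, hbm⟩ : ∃ m ∈ Set.Icc 1 (n - 1), b ⬝ᵥ codeDiff (unaryEncoding n) m ≠ 0 := by
      by_contra! h
      exact hb0 (eq_zero_of_forall_dotProduct_codeDiff hsum h)
    have hother : ∀ r ∈ Set.Icc 1 (n - 1), r ≠ m →
        b ⬝ᵥ codeDiff (unaryEncoding n) r = 0 := by
      intro r hr hrm
      -- `w` lies in `M(b)`, and `m ∉ S` because `b · c^m ≠ 0`. So the coefficient of `c^m` in `w`,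
      -- which is `b · c^r`, must vanish.
      set w := (b ⬝ᵥ codeDiff (unaryEncoding n) r) • codeDiff (unaryEncoding n) m
        - (b ⬝ᵥ codeDiff (unaryEncoding n) m) • codeDiff (unaryEncoding n) r with hw
      have hwmem := hmem w
        (Submodule.sub_mem _ (Submodule.smul_mem _ _ (codeDiff_mem_codeSpace _ m))
          (Submodule.smul_mem _ _ (codeDiff_mem_codeSpace _ r)))
        (by simp only [hw, dotProduct_sub, dotProduct_smul, smul_eq_mul]; ring)
      have h0 := partialSum_eq_zero_of_mem_span hS (fun h => hbm (hS0 m h)) hwmem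
      simpa [hw, partialSum_codeDiff m hm, partialSum_codeDiff m hr, hrm] using h0
    -- The factor is forced by `splitNormal n m · c^m = n`.
    refine ⟨m, hm, b ⬝ᵥ codeDiff (unaryEncoding n) m / n, div_ne_zero hbm hn', ?_⟩
    rw [← sub_eq_zero]
    apply eq_zero_of_forall_dotProduct_codeDiff
    · simp only [Pi.sub_apply, Pi.smul_apply, smul_eq_mul, Finset.sum_sub_distrib,
        ← Finset.mul_sum, hsum, sum_splitNormal (show m ≤ n by have := hm.2; omega)]
      ring
    · intro r hr
      rw [sub_dotProduct, smul_dotProduct, splitNormal_dotProduct_codeDiff m hr, smul_eq_mul]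
      split_ifs with hrm
      · subst hrm; field_simp; ring
      · rw [hother r hr hrm]; ring
  · rintro ⟨m, hm, t, ht, rfl⟩
    have hdot : ∀ r ∈ Set.Icc 1 (n - 1),
        (t • splitNormal n m) ⬝ᵥ codeDiff (unaryEncoding n) r = if r = m then t * n else 0 :=
      fun r hr => by
        rw [smul_dotProduct, splitNormal_dotProduct_codeDiff m hr]; split_ifs <;> simp
    refine ⟨?_, ?_, Set.Icc 1 (n - 1) \ {m}, Set.sdiff_subset, ?_⟩
    · exact Submodule.smul_mem _ _ (mem_codeSpace_unaryEncoding.2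
        (sum_splitNormal (by have := hm.2; omega)))
    · intro h
      have := hdot m hm
      rw [h, zero_dotProduct, if_pos rfl] at this
      exact mul_ne_zero ht hn' this.symm
    · apply Set.Subset.antisymm
      · rintro y ⟨hyL, hy⟩
        have hys := sum_neg_partialSum_smul_codeDiff (mem_codeSpace_unaryEncoding.1 hyL)
        -- Only `c^m` pairs nontrivially with the normal, so orthogonality kills exactly its
        -- coefficient in `y`.
        have hym : partialSum n m y = 0 := by
          rw [← hys, dotProduct_sum] at hy
          rw [Finset.sum_eq_single m (fun r hr hrm => by
            rw [dotProduct_smul, hdot r (by simpa using hr), if_neg hrm, smul_zero])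
            (fun h => absurd (by simpa using hm) h), dotProduct_smul, hdot m hm, if_pos rfl] at hy
          simpa [ht, hn'] using hy
        rw [← hys]
        refine Submodule.sum_mem _ fun r hr => ?_
        by_cases hrm : r = m
        · rw [hrm, hym, neg_zero, zero_smul]
          exact Submodule.zero_mem _
        · exact Submodule.smul_mem _ _
            (Submodule.subset_span ⟨r, ⟨by simpa using hr, hrm⟩, rfl⟩)
      · intro y hy
        have hle : Submodule.span ℝ (codeDiff (unaryEncoding n) '' (Set.Icc 1 (n - 1) \ {m}))
            ≤ codeSpace (unaryEncoding n)
              ⊓ LinearMap.ker (dotProductBilin ℝ ℝ (t • splitNormal n m)) := by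
          rw [Submodule.span_le]
          rintro _ ⟨r, hr, rfl⟩
          refine ⟨codeDiff_mem_codeSpace _ r, ?_⟩
          have := hdot r hr.1
          rw [if_neg (show r ≠ m from hr.2)] at this
          exact this
        exact hle hy

/-! ### Counting the general inequalities -/

/-- The solutions of `∑ j, min (b · h^j) (b · h^(j-1)) * λ_j ≤ b · y`. -/
def lowerHalfspace {k : ℕ} (H : Fin n → Fin k → ℝ) (b : Fin k → ℝ) :
    Set ((Fin (n + 1) → ℝ) × (Fin k → ℝ)) :=
  {p | ∑ j : Fin (n + 1),
    min (b ⬝ᵥ code H ((j : ℕ) + 1)) (b ⬝ᵥ code H (j : ℕ)) * p.1 j ≤ b ⬝ᵥ p.2}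

/-- The solutions of `b · y ≤ ∑ j, max (b · h^j) (b · h^(j-1)) * λ_j`. -/
def upperHalfspace {k : ℕ} (H : Fin n → Fin k → ℝ) (b : Fin k → ℝ) :
    Set ((Fin (n + 1) → ℝ) × (Fin k → ℝ)) :=
  {p | b ⬝ᵥ p.2 ≤ ∑ j : Fin (n + 1),
    max (b ⬝ᵥ code H ((j : ℕ) + 1)) (b ⬝ᵥ code H (j : ℕ)) * p.1 j}

theorem lowerHalfspace_smul_of_pos {k : ℕ} (H : Fin n → Fin k → ℝ) (b : Fin k → ℝ) {t : ℝ}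
    (ht : 0 < t) : lowerHalfspace H (t • b) = lowerHalfspace H b := by
  ext p
  simp only [lowerHalfspace, Set.mem_ofPred_eq, smul_dotProduct, smul_eq_mul,
    ← mul_min_of_nonneg _ _ ht.le, mul_assoc, ← Finset.mul_sum, mul_le_mul_iff_right₀ ht]

theorem lowerHalfspace_neg {k : ℕ} (H : Fin n → Fin k → ℝ) (b : Fin k → ℝ) :
    lowerHalfspace H (-b) = upperHalfspace H b := by
  ext p
  simp only [lowerHalfspace, upperHalfspace, Set.mem_ofPred_eq, neg_dotProduct, min_neg_neg,
    neg_mul, Finset.sum_neg_distrib, neg_le_neg_iff]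

theorem upperHalfspace_neg {k : ℕ} (H : Fin n → Fin k → ℝ) (b : Fin k → ℝ) :
    upperHalfspace H (-b) = lowerHalfspace H b := by
  rw [← lowerHalfspace_neg, neg_neg]

theorem upperHalfspace_smul_of_pos {k : ℕ} (H : Fin n → Fin k → ℝ) (b : Fin k → ℝ) {t : ℝ}
    (ht : 0 < t) : upperHalfspace H (t • b) = upperHalfspace H b := by
  rw [← lowerHalfspace_neg, ← smul_neg, lowerHalfspace_smul_of_pos H _ ht, lowerHalfspace_neg]

/-- Truncated subtraction realizes `h^0 = h^1`; the cap at `h^n` can be dropped because `m < n`. -/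
theorem dotProduct_splitNormal_code {m : ℕ} (hm : m ∈ Set.Icc 1 (n - 1)) (k : ℕ) :
    splitNormal n m ⬝ᵥ code (unaryEncoding n) k
      = if k - 1 + 1 ≤ m then (m : ℝ) - n else m := by
  obtain ⟨h1, h2⟩ := hm
  rw [dotProduct_code_unaryEncoding, splitNormal]
  dsimp only
  split_ifs <;> first | omega | rfl

/-- The minimum is `m - n` unless `h^(j-1)` and `h^j` both lie beyond the cut, where it is larger by
`n`. Cancelling `(m - n) * ∑ λ` against `(m - n) * ∑ y` and dividing by `n` leaves the suffix
inequality. The maximum yields the prefix inequality in the same way. -/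
theorem mem_lowerHalfspace_splitNormal {m : ℕ} (hm : m ∈ Set.Icc 1 (n - 1))
    {p : (Fin (n + 1) → ℝ) × (Fin n → ℝ)} (h : ∑ i, p.2 i = ∑ j, p.1 j) :
    p ∈ lowerHalfspace (unaryEncoding n) (splitNormal n m) ↔ 0 ≤ suffixGap n m p := by
  have hn : (0 : ℝ) < n := by exact_mod_cast NeZero.pos n
  have hl : ∀ j : Fin (n + 1), min (splitNormal n m ⬝ᵥ code (unaryEncoding n) ((j : ℕ) + 1))
      (splitNormal n m ⬝ᵥ code (unaryEncoding n) (j : ℕ)) * p.1 j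
      = ((m : ℝ) - n) * p.1 j + n * if m + 2 ≤ j.val + 1 then p.1 j else 0 := by
    intro j
    have h1 := hm.1
    rw [dotProduct_splitNormal_code hm, dotProduct_splitNormal_code hm]
    have hle : (m : ℝ) - n ≤ m := by linarith
    split_ifs <;> first | omega | (simp only [min_self, min_eq_right hle]; ring)
  have hr : splitNormal n m ⬝ᵥ p.2
      = ∑ i, (((m : ℝ) - n) * p.2 i + n * if m + 1 ≤ i.val + 1 then p.2 i else 0) := by
    refine Finset.sum_congr rfl fun i _ => ?_
    rw [splitNormal]
    split_ifs <;> first | omega | ring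
  simp only [lowerHalfspace, Set.mem_ofPred_eq, hl, hr, Finset.sum_add_distrib,
    ← Finset.mul_sum, h, add_le_add_iff_left, mul_le_mul_iff_right₀ hn, suffixGap_apply,
    sub_nonneg, Finset.sum_filter]

theorem mem_upperHalfspace_splitNormal {m : ℕ} (hm : m ∈ Set.Icc 1 (n - 1))
    {p : (Fin (n + 1) → ℝ) × (Fin n → ℝ)} (h : ∑ i, p.2 i = ∑ j, p.1 j) :
    p ∈ upperHalfspace (unaryEncoding n) (splitNormal n m) ↔ 0 ≤ prefixGap n m p := by
  have hn : (0 : ℝ) < n := by exact_mod_cast NeZero.pos n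
  have hl : ∀ j : Fin (n + 1), max (splitNormal n m ⬝ᵥ code (unaryEncoding n) ((j : ℕ) + 1))
      (splitNormal n m ⬝ᵥ code (unaryEncoding n) (j : ℕ)) * p.1 j
      = (m : ℝ) * p.1 j - n * if j.val + 1 ≤ m then p.1 j else 0 := by
    intro j
    have h1 := hm.1
    rw [dotProduct_splitNormal_code hm, dotProduct_splitNormal_code hm]
    have hle : (m : ℝ) - n ≤ m := by linarith
    split_ifs <;> first | omega | (simp only [max_self, max_eq_left hle]; ring)
  have hr : splitNormal n m ⬝ᵥ p.2
      = ∑ i, ((m : ℝ) * p.2 i - n * if i.val + 1 ≤ m then p.2 i else 0) := by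
    refine Finset.sum_congr rfl fun i _ => ?_
    rw [splitNormal]
    split_ifs <;> first | omega | ring
  simp only [upperHalfspace, Set.mem_ofPred_eq, hl, hr, Finset.sum_sub_distrib,
    ← Finset.mul_sum, h, sub_le_sub_iff_left, mul_le_mul_iff_right₀ hn, prefixGap_apply,
    sub_nonneg, Finset.sum_filter]

/-- The general inequalities for the unary encoding. -/
def splitHalfspace (n : ℕ) [NeZero n] :
    Fin (n - 1) ⊕ Fin (n - 1) → Set ((Fin (n + 1) → ℝ) × (Fin n → ℝ)) :=
  Sum.elim (fun k => lowerHalfspace (unaryEncoding n) (splitNormal n (k + 1)))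
    (fun k => upperHalfspace (unaryEncoding n) (splitNormal n (k + 1)))

theorem generalInequalities_unaryEncoding :
    generalInequalities (unaryEncoding n) = Set.range (splitHalfspace n) := by
  ext W
  constructor
  · rintro ⟨b, hb, hW⟩
    obtain ⟨m, ⟨h1, h2⟩, t, ht, rfl⟩ := isSpannedNormal_unaryEncoding_iff.1 hb
    obtain ⟨k, rfl⟩ : ∃ k, m = k + 1 := ⟨m - 1, by omega⟩
    change W = lowerHalfspace _ _ ∨ W = upperHalfspace _ _ at hW
    rcases ht.lt_or_gt with ht | ht
    · rw [← neg_smul_neg, smul_neg, lowerHalfspace_neg, upperHalfspace_neg,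
        upperHalfspace_smul_of_pos _ _ (neg_pos.2 ht),
        lowerHalfspace_smul_of_pos _ _ (neg_pos.2 ht)] at hW
      rcases hW with rfl | rfl
      · exact ⟨Sum.inr ⟨k, by omega⟩, rfl⟩
      · exact ⟨Sum.inl ⟨k, by omega⟩, rfl⟩
    · rw [upperHalfspace_smul_of_pos _ _ ht, lowerHalfspace_smul_of_pos _ _ ht] at hW
      rcases hW with rfl | rfl
      · exact ⟨Sum.inl ⟨k, by omega⟩, rfl⟩
      · exact ⟨Sum.inr ⟨k, by omega⟩, rfl⟩
  · have hmem : ∀ k : Fin (n - 1), IsSpannedNormal (unaryEncoding n) (splitNormal n (k + 1)) :=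
      fun k => isSpannedNormal_unaryEncoding_iff.2
        ⟨k + 1, ⟨by omega, by omega⟩, 1, one_ne_zero, (one_smul ℝ _).symm⟩
    rintro ⟨k | k, rfl⟩
    · exact ⟨_, hmem k, Or.inl rfl⟩
    · exact ⟨_, hmem k, Or.inr rfl⟩

/-- The facet of the embedding that `splitHalfspace` induces. -/
def splitIndex (n : ℕ) : Fin (n - 1) ⊕ Fin (n - 1) → Fin n ⊕ Fin n :=
  -- Only the suffix side is shifted, since `sos2Gap` at `Sum.inr i` is already the prefix gap at `i
  -- + 1`.
  Sum.map (fun k => ⟨k + 1, by omega⟩) (fun k => ⟨k, by omega⟩)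

omit [NeZero n] in
theorem splitIndex_injective : Function.Injective (splitIndex n) :=
  Function.Injective.sumMap (fun a b hab => by simpa [Fin.ext_iff] using hab)
    (fun a b hab => by simpa [Fin.ext_iff] using hab)

theorem mem_splitHalfspace_iff (s : Fin (n - 1) ⊕ Fin (n - 1))
    {p : (Fin (n + 1) → ℝ) × (Fin n → ℝ)} (h : ∑ i, p.2 i = ∑ j, p.1 j) :
    p ∈ splitHalfspace n s ↔ 0 ≤ sos2Gap n (splitIndex n s) p := by
  rcases s with k | k
  · exact mem_lowerHalfspace_splitNormal ⟨by omega, by omega⟩ h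
  · exact mem_upperHalfspace_splitNormal ⟨by omega, by omega⟩ h

theorem splitHalfspace_injective : Function.Injective (splitHalfspace n) := by
  intro s t hst
  by_contra hne
  have hφne := splitIndex_injective.ne hne
  -- This point satisfies `∑ y = ∑ λ` and has gap 2 for `t` and `-1` for `s`, so it separates the
  -- two half-spaces.
  set p := (2 : ℝ) • sos2Vertex n (splitIndex n t) - sos2Vertex n (splitIndex n s) with hp
  have hsum : ∑ i, p.2 i = ∑ j, p.1 j := by
    simp only [hp, Prod.snd_sub, Prod.fst_sub, Prod.smul_snd, Prod.smul_fst, Pi.sub_apply,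
      Pi.smul_apply, smul_eq_mul, Finset.sum_sub_distrib, ← Finset.mul_sum, sum_sos2Vertex_fst,
      sum_sos2Vertex_snd]
  have ht : p ∈ splitHalfspace n t := by
    rw [mem_splitHalfspace_iff t hsum]
    simp [hp, sos2Gap_sos2Vertex, hφne.symm]
  rw [← hst, mem_splitHalfspace_iff s hsum] at ht
  simp [hp, sos2Gap_sos2Vertex, hφne] at ht
  linarith

theorem sizeG_unaryEncoding : sizeG (unaryEncoding n) = 2 * (n - 1) := by
  rw [sizeG, generalInequalities_unaryEncoding,
    Set.ncard_range_of_injective splitHalfspace_injective]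
  simp only [Nat.card_eq_fintype_card, Fintype.card_sum, Fintype.card_fin]
  omega

/-! ### Counting the variable bounds -/

theorem boundIndices_unaryEncoding : boundIndices (unaryEncoding n) = {1, n + 1} := by
  refine Set.union_eq_left.2 ?_
  rintro j ⟨⟨h1, h2⟩, hspan⟩
  have hj : j - 1 ∈ Set.Icc 1 (n - 1) := ⟨by omega, by omega⟩
  have hmem := codeDiff_mem_codeSpace (unaryEncoding n) (j - 1)
  rw [hspan] at hmem
  -- If the remaining differences spanned `L(H)`, they would span `c^(j-1)`, whose partial sum at `j
  -- - 1` is `-1`.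
  have h0 := partialSum_eq_zero_of_mem_span Set.sdiff_subset (m := j - 1) (by simp) hmem
  rw [partialSum_codeDiff _ hj, if_pos rfl] at h0
  norm_num at h0

theorem sizeB_unaryEncoding : sizeB (unaryEncoding n) = 2 := by
  have hn := NeZero.pos n
  have hset : boundInequalities (unaryEncoding n)
      = {{p | 0 ≤ p.1 0}, {p | 0 ≤ p.1 (Fin.last n)}} := by
    ext W
    simp only [boundInequalities, boundIndices_unaryEncoding, Set.mem_ofPred_eq,
      Set.mem_insert_iff, Set.mem_singleton_iff]
    constructor
    · rintro ⟨j, hj | hj, rfl⟩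
      · rw [show j = 0 from Fin.ext (by simpa using hj)]
        exact Or.inl rfl
      · rw [show j = Fin.last n from Fin.ext (by simpa using hj)]
        exact Or.inr rfl
    · rintro (rfl | rfl)
      · exact ⟨0, Or.inl rfl, rfl⟩
      · exact ⟨Fin.last n, Or.inr rfl, rfl⟩
  rw [sizeB, hset, Set.ncard_pair]
  intro h
  have hlast : Fin.last n ≠ 0 := fun h => hn.ne' (by simpa using congrArg Fin.val h)
  -- This point satisfies the last bound but violates the first; they concern different entries
  -- because `n ≥ 1`.
  have hmem : (Pi.single 0 (-1), 0) ∈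
      {p : (Fin (n + 1) → ℝ) × (Fin n → ℝ) | 0 ≤ p.1 (Fin.last n)} := by
    simp [hlast]
  rw [← h] at hmem
  norm_num at hmem

end UnarySizes
theorem corollary2 (n : ℕ) [NeZero n] :
    (∀ (lam : Fin (n + 1) → ℝ) (y : Fin n → ℝ),
      (lam, y) ∈ embeddingHull (sos2 n) (unaryEncoding n) ↔
        (∑ j, lam j = 1 ∧ ∑ i, y i = 1) ∧
        (∀ l ∈ Finset.Icc 1 (n - 1),
          (∑ j : Fin (n + 1) with l + 2 ≤ j.val + 1, lam j
              ≤ ∑ i : Fin n with l + 1 ≤ i.val + 1, y i) ∧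
          (∑ j : Fin (n + 1) with j.val + 1 ≤ l, lam j
              ≤ ∑ i : Fin n with i.val + 1 ≤ l, y i)) ∧
        0 ≤ lam 0 ∧ 0 ≤ lam (Fin.last n)) ∧
    (∀ l ∈ Finset.Icc 1 (n - 1),
      IsFacetDefining (embeddingHull (sos2 n) (unaryEncoding n))
        ((∑ j : Fin (n + 1) with l + 2 ≤ j.val + 1, lamCoord j)
          - (∑ i : Fin n with l + 1 ≤ i.val + 1, yCoord i)) 0 ∧
      IsFacetDefining (embeddingHull (sos2 n) (unaryEncoding n))
        ((∑ j : Fin (n + 1) with j.val + 1 ≤ l, lamCoord j)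
          - (∑ i : Fin n with i.val + 1 ≤ l, yCoord i)) 0) ∧
    IsFacetDefining (embeddingHull (sos2 n) (unaryEncoding n)) (-lamCoord 0) 0 ∧
    IsFacetDefining (embeddingHull (sos2 n) (unaryEncoding n)) (-lamCoord (Fin.last n)) 0 ∧
    polySize (embeddingHull (sos2 n) (unaryEncoding n)) = 2 * n + 4 ∧
    sizeG (unaryEncoding n) = 2 * (n - 1) ∧
    sizeB (unaryEncoding n) = 2 := by
  have hn := NeZero.pos n
  refine ⟨mem_embeddingHull_iff, fun l hl => ?_, isFacetDefining_neg_lamCoord_zero,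
    isFacetDefining_neg_lamCoord_last, polySize_embeddingHull, sizeG_unaryEncoding,
    sizeB_unaryEncoding⟩
  rw [Finset.mem_Icc] at hl
  have hprefix := isFacetDefining_neg_prefixGap (n := n) (l := l - 1) (by omega)
  rw [Nat.sub_add_cancel hl.1, prefixGap, neg_sub] at hprefix
  have hsuffix := isFacetDefining_neg_suffixGap (n := n) (l := l) (by omega)
  rw [suffixGap, neg_sub] at hsuffix
  exact ⟨hsuffix, hprefix⟩
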